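/- Let $(\Omega,\mathcal F)$ be a measurable space, let $\mathcal P$ be a nonempty set of probability measures on it, and let $\mathsf Q$ be a probability measure on it. **Definitions.** $\mathsf Q\ll\mathcal P$ means that $\mathsf Q(A)=0$ for every event $A$ with $\mathsf P(A)=0$ for all $\mathsf P\in\mathcal P$. An *e-variable* is a measurable $X\colon\Omega\to[0,\infty]$ with $\mathbb E_{\mathsf P}[X]\le 1$ for all $\mathsf P\in\mathcal P$. A *numeraire* is a $\mathsf Q$-almost surely strictly positive e-variable $X^*$ such that $\mathbb E_{\mathsf Q}[X/X^*]\le 1$ for every e-variable $X$ (with $x/\infty=0$ and $\infty/x=\infty$ for $x<\infty$, and $\infty/\infty=1$). The *reverse information projection* (RIPr) of $\mathsf Q$ is the measure $\mathsf P^*$ with $d\mathsf P^*/d\mathsf Q=1/X^*$ (zero where $X^*=\infty$), where $X^*$ is a numeraire. If all $\mathsf P\in\mathcal P$ are absolutely continuous with respect to a probability measure $\mu$, write $p=d\mathsf P/d\mu$ and identify $\mathsf P$ with $p$. The *maximum description gain* of switching from $p\in\mathcal P$ to an element of $\mathcal P$ is $$H(\mathsf Q\mid p\leadsto\mathcal P)=\sup_{p'\in\mathcal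 P}\mathbb E_{\mathsf Q}\Big[\log\frac{p'}{p}\Big]$$ if $\mathsf Q\ll\mathsf P$, and $+\infty$ otherwise. Here $\log 0=-\infty$, and $\mathbb E_{\mathsf Q}[Y]=-\infty$ whenever $\mathbb E_{\mathsf Q}[Y^-]=\infty$. For measurable $f_n,f\colon\Omega\to[0,\infty]$, "$\log f_n\to\log f$ in $L^1(\mathsf Q)$" means $\mathbb E_{\mathsf Q}[|\log f_n-\log f|]\to0$ (the integrand being $\infty$ wherever $f_n$ or $f$ is $0$ or $\infty$); the individual functions $\log f_n$ need not be $\mathsf Q$-integrable. **Corollary.** Assume that $\mathsf Q\ll\mathcal P$, that all elements of $\mathcal P$ are absolutely continuous with respect to a probability measure $\mu$, and that $\mathcal P$ is convex. 1. If $(p_n)_{n\in\mathbb N}$ is a sequence in $\mathcal P$ with $H(\mathsf Q\mid p_n\leadsto\mathcal P)\to0$, then the RIPr $\mathsf P^*$ exists and is unique, and $\log p_n\to\log p^*$ in $L^1(\mathsf Q)$, where $p^*=d\mathsf P^*/d\mu$. 2. This recovers the definition of the RIPr by Harremoës et al.: if $H(\mathsf Q\mid p\leadsto\mathcal P)<\infty$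 for some $p\in\mathcal P$, then the RIPr $\mathsf P^*$ exists and is unique, and, with $p^*=d\mathsf P^*/d\mu$, a measurable function $r\colon\Omega\to[0,\infty]$ satisfies $r=p^*$ $\mathsf Q$-almost surely if and only if $\log p_n\to\log r$ in $L^1(\mathsf Q)$ for every sequence $(p_n)_{n\in\mathbb N}$ in $\mathcal P$ with $H(\mathsf Q\mid p_n\leadsto\mathcal P)\to\inf_{p\in\mathcal P}H(\mathsf Q\mid p\leadsto\mathcal P)$. -/

import Mathlib

open MeasureTheory Filter Topology
open scoped ENNReal NNReal

/-- `Q ≪ H₀`: every event that is null under all elements of `H₀` is null under `Q`. -/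
def AbsContSet {Ω : Type*} [MeasurableSpace Ω] (Q : Measure Ω) (H₀ : Set (Measure Ω)) : Prop :=
  ∀ A : Set Ω, MeasurableSet A → (∀ P ∈ H₀, P A = 0) → Q A = 0

/-- E-variables for the null hypothesis `H₀` (a set of probability measures): measurable `[0, ∞]`-valued functions with
expectation at most one under every element of `H₀`. -/
def IsEVariable {Ω : Type*} [MeasurableSpace Ω] (H₀ : Set (Measure Ω)) (X : Ω → ℝ≥0∞) : Prop :=
  Measurable X ∧ ∀ P ∈ H₀, ∫⁻ ω, X ω ∂P ≤ 1

open Classical in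
/-- Ratio of `[0, ∞]`-valued quantities with the conventions `x / ∞ = 0` and `∞ / x = ∞` for
`x < ∞` (as in Mathlib), and `∞ / ∞ = 1` (unlike Mathlib). -/
noncomputable def extRatio (x y : ℝ≥0∞) : ℝ≥0∞ :=
  if x = ⊤ ∧ y = ⊤ then 1 else x / y

/-- Numeraire e-variables: `Q`-almost surely strictly positive e-variables `Xstar` such that
`E_Q[X / Xstar] ≤ 1` for every e-variable `X`. -/
def IsNumeraire {Ω : Type*} [MeasurableSpace Ω] (H₀ : Set (Measure Ω)) (Q : Measure Ω)
    (Xstar : Ω → ℝ≥0∞) : Prop :=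
  IsEVariable H₀ Xstar ∧ (∀ᵐ ω ∂Q, 0 < Xstar ω) ∧
    ∀ X : Ω → ℝ≥0∞, IsEVariable H₀ X → ∫⁻ ω, extRatio (X ω) (Xstar ω) ∂Q ≤ 1

/-- The reverse information projection (RIPr): the measure with `Q`-density `1 / Xstar`, where
`Xstar` is a numeraire (the density is zero where `Xstar = ∞`). -/
def IsRIPr {Ω : Type*} [MeasurableSpace Ω] (H₀ : Set (Measure Ω)) (Q Pstar : Measure Ω) : Prop :=
  ∃ Xstar : Ω → ℝ≥0∞, IsNumeraire H₀ Q Xstar ∧ Pstar = Q.withDensity (fun ω => (Xstar ω)⁻¹)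

/-- Extended expectation `E_Q[f] = E_Q[f⁺] - E_Q[f⁻]` of an extended real-valued function; it is
`-∞` whenever `E_Q[f⁻] = ∞` (the `EReal` convention is `∞ - ∞ = -∞`). -/
noncomputable def extExpectation {Ω : Type*} [MeasurableSpace Ω] (Q : Measure Ω) (f : Ω → EReal) :
    EReal :=
  ((∫⁻ ω, (f ω).toENNReal ∂Q : ℝ≥0∞) : EReal) - ((∫⁻ ω, (-f ω).toENNReal ∂Q : ℝ≥0∞) : EReal)

open Classical in
/-- The maximum description gain `H(Q | p ⇝ H₀)` of switching from `P` (with `μ`-density `p`) to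
some element of `H₀`: the supremum of `E_Q[log (p' / p)]` over `P' ∈ H₀` (with `μ`-density `p'`)
if `Q ≪ P`, and `∞` otherwise. Here `ENNReal.log 0 = -∞`. -/
noncomputable def maxDescriptionGain {Ω : Type*} [MeasurableSpace Ω] (μ Q : Measure Ω)
    (H₀ : Set (Measure Ω)) (P : Measure Ω) : EReal :=
  if Q ≪ P then
    ⨆ P' ∈ H₀, extExpectation Q (fun ω => ENNReal.log (P'.rnDeriv μ ω / P.rnDeriv μ ω))
  else ⊤

/-- The `L¹(Q)` distance `E_Q[|log f - log g|] ∈ [0, ∞]` between the logarithms of two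
`[0, ∞]`-valued functions; the integrand is `∞` wherever `f` or `g` is `0` or `∞`. -/
noncomputable def logL1Dist {Ω : Type*} [MeasurableSpace Ω] (Q : Measure Ω) (f g : Ω → ℝ≥0∞) :
    ℝ≥0∞ :=
  ∫⁻ ω, (ENNReal.log (f ω) - ENNReal.log (g ω)).abs ∂Q

/-- The definition of the reverse information projection through the description gain: `r` is a
measurable function such that `log p_n → log r` in `L¹(Q)` for every sequence `p_n` in `H₀` whose
maximum description gains converge to the infimum of the maximum description gain over `H₀`. -/
def IsDescriptionGainProjection {Ω : Type*} [MeasurableSpace Ω] (μ Q : Measure Ω)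
    (H₀ : Set (Measure Ω)) (r : Ω → ℝ≥0∞) : Prop :=
  Measurable r ∧ ∀ p : ℕ → Measure Ω, (∀ n, p n ∈ H₀) →
    Tendsto (fun n => maxDescriptionGain μ Q H₀ (p n)) atTop
      (𝓝 (⨅ P ∈ H₀, maxDescriptionGain μ Q H₀ P)) →
    Tendsto (fun n => logL1Dist Q ((p n).rnDeriv μ) r) atTop (𝓝 0)

/-! ### Extended expectations of real-valued functions -/

/-! Convexity puts (p + t p')/(1 + t) in the hypothesis, so with R = p'/p the gain of p bounds
E_Q[log(1 + tR)] by that gain plus log(1 + t) (`lintegral_log_one_add_mul_ratio_le`). Two values of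
t do the work.

With t = 1 in both directions, the sum log(1 + R) + log(1 + 1/R) equals 2 log 2 + 2 log cosh(log R /
2). If both gains are at most s², lines below log cosh then give E_Q|log R| ≤ 4s
(`logL1Dist_rnDeriv_le`). Hence vanishing gains make log p_n Cauchy in L¹(Q), with a limit log r.

Letting n → ∞ and then t → 0, Fatou's lemma yields E_Q[p/r] ≤ 1 for every p in the hypothesis
(`lintegral_rnDeriv_div_limit_le_one`). With q = dQ/dμ this says that q/r is an e-variable. Fatou
along p_n also gives E_Q[X r/q] ≤ 1 for each e-variable X, so q/r is a numeraire and r is Q-a.s. the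
μ-density of the RIPr. Numeraires are Q-a.s. unique by the equality case of X/Y + Y/X ≥ 2.

For the second part, an element within ε of the supremum defining a finite gain has gain at most ε,
by additivity of log ratios. So the infimum is 0, and the sequences approaching it are those of the
first part. -/

theorem extExpectation_congr_ae {Ω : Type*} [MeasurableSpace Ω] {Q : Measure Ω} {f g : Ω → EReal}
    (h : f =ᵐ[Q] g) : extExpectation Q f = extExpectation Q g := by
  unfold extExpectation
  rw [lintegral_congr_ae (g := fun ω => (g ω).toENNReal)
    (h.mono fun ω hω => by simp only [hω]),
    lintegral_congr_ae (f := fun ω => (-f ω).toENNReal) (g := fun ω => (-g ω).toENNReal)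
      (h.mono fun ω hω => by simp only [hω])]

theorem extExpectation_coe {Ω : Type*} [MeasurableSpace Ω] (Q : Measure Ω) (g : Ω → ℝ) :
    extExpectation Q (fun ω => (g ω : EReal)) =
      ((∫⁻ ω, ENNReal.ofReal (g ω) ∂Q : ℝ≥0∞) : EReal) -
        ((∫⁻ ω, ENNReal.ofReal (-g ω) ∂Q : ℝ≥0∞) : EReal) := by
  simp only [extExpectation, ← EReal.coe_neg, EReal.real_coe_toENNReal]

theorem lintegral_neg_part_ne_top_of_extExpectation_ne_bot {Ω : Type*} [MeasurableSpace Ω]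
    {Q : Measure Ω} {f : Ω → EReal} (h : extExpectation Q f ≠ ⊥) :
    ∫⁻ ω, (-f ω).toENNReal ∂Q ≠ ⊤ := by
  intro h'
  apply h
  simp [extExpectation, h', sub_eq_add_neg]

theorem extExpectation_of_integrable {Ω : Type*} [MeasurableSpace Ω] {Q : Measure Ω} {g : Ω → ℝ}
    (hg : Integrable g Q) : extExpectation Q (fun ω => (g ω : EReal)) = ((∫ ω, g ω ∂Q : ℝ) : EReal) := by
  have h1 : ∫⁻ ω, ENNReal.ofReal (g ω) ∂Q ≠ ⊤ := hg.lintegral_lt_top.ne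
  have h2 : ∫⁻ ω, ENNReal.ofReal (-g ω) ∂Q ≠ ⊤ := hg.neg.lintegral_lt_top.ne
  rw [extExpectation_coe, integral_eq_lintegral_pos_part_sub_lintegral_neg_part hg,
    EReal.coe_sub, EReal.coe_ennreal_toReal h1, EReal.coe_ennreal_toReal h2]

/-- Because ∞ - ∞ = -∞, an upper bound alone does not control the positive part; once the negative
part is finite, an infinite positive part would make the expectation `⊤`. -/
theorem integrable_of_extExpectation_le {Ω : Type*} [MeasurableSpace Ω] {Q : Measure Ω} {g : Ω → ℝ}
    (hgm : Measurable g) (hneg : ∫⁻ ω, ENNReal.ofReal (-g ω) ∂Q ≠ ⊤) {h : ℝ}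
    (hle : extExpectation Q (fun ω => (g ω : EReal)) ≤ (h : EReal)) :
    Integrable g Q ∧ ∫ ω, g ω ∂Q ≤ h := by
  have hpos : ∫⁻ ω, ENNReal.ofReal (g ω) ∂Q ≠ ⊤ := by
    intro htop
    rw [extExpectation_coe, htop] at hle
    lift (∫⁻ ω, ENNReal.ofReal (-g ω) ∂Q) to ℝ≥0 using hneg with b
    have hb : ((⊤ : ℝ≥0∞) : EReal) - ((b : ℝ≥0∞) : EReal) = ⊤ := by
      rw [EReal.coe_ennreal_top]
      exact EReal.top_sub_coe (b : ℝ)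
    rw [hb] at hle
    exact absurd hle (not_le.2 (EReal.coe_lt_top h))
  have hint : Integrable g Q := by
    refine ⟨hgm.aestronglyMeasurable, ?_⟩
    have hle' : ∀ ω, ‖g ω‖ₑ ≤ ENNReal.ofReal (g ω) + ENNReal.ofReal (-g ω) := by
      intro ω
      rw [← ofReal_norm, Real.norm_eq_abs]
      rcases le_total 0 (g ω) with h0 | h0
      · rw [abs_of_nonneg h0]; exact le_self_add
      · rw [abs_of_nonpos h0]; exact le_add_self
    refine lt_of_le_of_lt (lintegral_mono hle') ?_
    rw [lintegral_add_left hgm.ennreal_ofReal]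
    exact ENNReal.add_lt_top.2 ⟨hpos.lt_top, hneg.lt_top⟩
  refine ⟨hint, ?_⟩
  rw [extExpectation_of_integrable hint] at hle
  exact_mod_cast hle

/-! ### Logarithmic distances -/

theorem EReal.abs_sub_comm' (x y : EReal) : (x - y).abs = (y - x).abs := by
  induction x <;> induction y <;> simp [sub_eq_add_neg]
  rename_i a b
  rw [← EReal.coe_neg, ← EReal.coe_neg, ← EReal.coe_add, ← EReal.coe_add, EReal.abs_def,
    EReal.abs_def, ← sub_eq_add_neg, ← sub_eq_add_neg, abs_sub_comm]

theorem EReal.abs_sub_le_abs_sub_add (x y z : EReal) :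
    (x - z).abs ≤ (x - y).abs + (y - z).abs := by
  induction y
  · simp
  · induction x <;> induction z <;> try simp [sub_eq_add_neg]
    rename_i y x z
    rw [← sub_eq_add_neg, ← sub_eq_add_neg, ← sub_eq_add_neg, ← EReal.coe_sub, ← EReal.coe_sub,
      ← EReal.coe_sub, EReal.abs_def, EReal.abs_def, EReal.abs_def,
      ← ENNReal.ofReal_add (abs_nonneg _) (abs_nonneg _)]
    exact ENNReal.ofReal_le_ofReal (abs_sub_le _ _ _)
  · induction x <;> simp [sub_eq_add_neg]

theorem ENNReal.measurable_abs_log_sub_log {Ω : Type*} [MeasurableSpace Ω] {f g : Ω → ℝ≥0∞}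
    (hf : Measurable f) (hg : Measurable g) :
    Measurable fun ω => (ENNReal.log (f ω) - ENNReal.log (g ω)).abs := by
  have habs : Measurable EReal.abs := by
    have : EReal.abs = fun x : EReal => max x.toENNReal (-x).toENNReal := by
      ext x
      induction x
      · simp
      · rename_i a
        rw [← EReal.coe_neg, EReal.abs_def, EReal.real_coe_toENNReal, EReal.real_coe_toENNReal,
          abs_eq_max_neg, ENNReal.ofReal_max]
      · simp
    rw [this]
    fun_prop
  have h1 := hf.ennreal_log
  have h2 := hg.ennreal_log
  exact habs.comp (h1.add h2.neg)

theorem ENNReal.abs_log_sub_log {a b : ℝ≥0∞} (ha : a ≠ 0) (ha' : a ≠ ⊤) (hb : b ≠ 0) (hb' : b ≠ ⊤) :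
    (ENNReal.log a - ENNReal.log b).abs = ‖Real.log a.toReal - Real.log b.toReal‖ₑ := by
  rw [ENNReal.log_pos_real ha ha', ENNReal.log_pos_real hb hb', ← EReal.coe_sub, EReal.abs_def,
    ← ofReal_norm, Real.norm_eq_abs]

theorem ENNReal.log_div_eq_coe {a b : ℝ≥0∞} (ha : a ≠ 0) (ha' : a ≠ ⊤) (hb : b ≠ 0) (hb' : b ≠ ⊤) :
    ENNReal.log (a / b) = ((Real.log a.toReal - Real.log b.toReal : ℝ) : EReal) := by
  have h1 : 0 < a.toReal := ENNReal.toReal_pos ha ha'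
  have h2 : 0 < b.toReal := ENNReal.toReal_pos hb hb'
  rw [ENNReal.log_pos_real (ENNReal.div_ne_zero.2 ⟨ha, hb'⟩) (ENNReal.div_ne_top ha' hb),
    ENNReal.toReal_div, Real.log_div h1.ne' h2.ne']

theorem logL1Dist_comm {Ω : Type*} [MeasurableSpace Ω] (Q : Measure Ω) (f g : Ω → ℝ≥0∞) :
    logL1Dist Q f g = logL1Dist Q g f :=
  lintegral_congr fun _ => EReal.abs_sub_comm' _ _

theorem logL1Dist_triangle {Ω : Type*} [MeasurableSpace Ω] (Q : Measure Ω) {f g k : Ω → ℝ≥0∞}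
    (hf : Measurable f) (hg : Measurable g) :
    logL1Dist Q f k ≤ logL1Dist Q f g + logL1Dist Q g k := by
  unfold logL1Dist
  rw [← lintegral_add_left (ENNReal.measurable_abs_log_sub_log hf hg)]
  exact lintegral_mono fun _ => EReal.abs_sub_le_abs_sub_add _ _ _

theorem logL1Dist_congr_right {Ω : Type*} [MeasurableSpace Ω] {Q : Measure Ω} (f : Ω → ℝ≥0∞)
    {g k : Ω → ℝ≥0∞} (h : g =ᵐ[Q] k) : logL1Dist Q f g = logL1Dist Q f k :=
  lintegral_congr_ae (h.mono fun ω hω => by simp only [hω])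

theorem ae_eq_of_logL1Dist_eq_zero {Ω : Type*} [MeasurableSpace Ω] {Q : Measure Ω}
    {f g : Ω → ℝ≥0∞} (hf : Measurable f) (hg : Measurable g) (h : logL1Dist Q f g = 0) :
    f =ᵐ[Q] g := by
  have h0 := (lintegral_eq_zero_iff (ENNReal.measurable_abs_log_sub_log hf hg)).1 h
  filter_upwards [h0] with ω hω
  have h1 : ENNReal.log (f ω) - ENNReal.log (g ω) = 0 := EReal.abs_eq_zero_iff.1 hω
  apply ENNReal.log_injective
  revert h1
  generalize ENNReal.log (f ω) = x
  generalize ENNReal.log (g ω) = y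
  intro h1
  -- A difference with an infinite entry is infinite, even ⊤ - ⊤ = ⊥, so only real entries survive.
  induction x <;> induction y <;> simp [sub_eq_add_neg] at h1 ⊢
  rename_i a b
  have : ((a - b : ℝ) : EReal) = 0 := by rw [EReal.coe_sub]; exact h1
  have h2 : a - b = 0 := by exact_mod_cast this
  linarith

/-! ### An elementary inequality -/

/-- Jensen's inequality for `exp` with weights (1 ± s)/2. The logarithms subtracted from the two
points cancel the weights, so the mean of the exponentials is cosh x · exp(-s x), while x drops out
of the mean of the points. The entropy term that remains is at most s² by log u ≤ u - 1. -/
theorem Real.mul_sub_sq_le_log_cosh {s : ℝ} (hs : 0 ≤ s) (hs1 : s < 1) (x : ℝ) :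
    s * x - s ^ 2 ≤ Real.log (Real.cosh x) := by
  have ha : 0 < 1 + s := by linarith
  have hb : 0 < 1 - s := by linarith
  have hconv := convexOn_exp.2
  replace hconv := hconv (Set.mem_univ ((1 - s) * x - Real.log (1 + s)))
    (Set.mem_univ (-(1 + s) * x - Real.log (1 - s))) (a := (1 + s) / 2) (b := (1 - s) / 2)
    (by positivity) (by linarith) (by ring)
  simp only [smul_eq_mul] at hconv
  rw [Real.exp_sub, Real.exp_sub, Real.exp_log ha, Real.exp_log hb] at hconv
  have h1 : (1 + s) / 2 * (Real.exp ((1 - s) * x) / (1 + s)) +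
      (1 - s) / 2 * (Real.exp (-(1 + s) * x) / (1 - s)) = Real.cosh x * Real.exp (-(s * x)) := by
    have e1 : (1 - s) * x = x + -(s * x) := by ring
    have e2 : -(1 + s) * x = -x + -(s * x) := by ring
    rw [Real.cosh_eq, e1, e2, Real.exp_add, Real.exp_add]
    field_simp
  rw [h1] at hconv
  have hl1 : Real.log (1 + s) ≤ s := by have := Real.log_le_sub_one_of_pos ha; linarith
  have hl2 : Real.log (1 - s) ≤ -s := by have := Real.log_le_sub_one_of_pos hb; linarith
  have h2 := Real.log_le_log (Real.exp_pos _) hconv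
  rw [Real.log_exp, Real.log_mul (Real.cosh_pos x).ne' (Real.exp_pos _).ne', Real.log_exp] at h2
  nlinarith

/-- Since (1 + R)(1 + 1/R) = 4 cosh²(log R / 2), this is the bound on log cosh at |log R| / 2. The
slope s stays free so that it can be matched to the square root of the gain. -/
theorem Real.mul_abs_log_le {s R : ℝ} (hs : 0 ≤ s) (hs1 : s < 1) (hR : 0 < R) :
    s * |Real.log R| + 2 * Real.log 2 ≤
      Real.log (1 + R) + Real.log (1 + R⁻¹) + 2 * s ^ 2 := by
  have h := Real.mul_sub_sq_le_log_cosh hs hs1 (|Real.log R| / 2)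
  have hcosh : Real.cosh (|Real.log R| / 2) = Real.cosh (Real.log R / 2) := by
    rw [← Real.cosh_abs (Real.log R / 2), abs_div, abs_of_pos (two_pos (α := ℝ))]
  have hsq : (1 + R) * (1 + R⁻¹) = 4 * Real.cosh (Real.log R / 2) ^ 2 := by
    have h2 : Real.cosh (2 * (Real.log R / 2)) = (R + R⁻¹) / 2 := by
      rw [mul_div_cancel₀ _ (two_ne_zero (α := ℝ)), Real.cosh_log hR]
    rw [Real.cosh_two_mul, Real.sinh_sq] at h2
    have : R * R⁻¹ = 1 := mul_inv_cancel₀ hR.ne'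
    nlinarith
  have hlog : Real.log (1 + R) + Real.log (1 + R⁻¹) =
      2 * Real.log 2 + 2 * Real.log (Real.cosh (Real.log R / 2)) := by
    have hR' : 0 < R⁻¹ := inv_pos.2 hR
    rw [← Real.log_mul (by positivity) (by positivity), hsq,
      Real.log_mul (by norm_num) (pow_pos (Real.cosh_pos _) 2).ne', Real.log_pow,
      show (4 : ℝ) = 2 ^ 2 by norm_num, Real.log_pow]
    norm_num
  rw [hcosh] at h
  rw [hlog]
  linarith

/-! ### Densities and the maximum description gain -/

section DescriptionGain

variable {Ω : Type*} [MeasurableSpace Ω] {μ Q : Measure Ω} {H₀ : Set (Measure Ω)}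

theorem AbsContSet.absolutelyContinuous (hQ : AbsContSet Q H₀) (hμ : ∀ P ∈ H₀, P ≪ μ) : Q ≪ μ :=
  Measure.AbsolutelyContinuous.mk fun A hA h0 => hQ A hA fun P hP => hμ P hP h0

theorem ae_rnDeriv_ne_zero_of_absolutelyContinuous {P : Measure Ω} [SigmaFinite μ] [SigmaFinite P]
    (hQP : Q ≪ P) (hPμ : P ≪ μ) : ∀ᵐ ω ∂Q, P.rnDeriv μ ω ≠ 0 :=
  hQP.ae_le ((Measure.rnDeriv_pos hPμ).mono fun _ h => h.ne')

theorem ae_rnDeriv_ne_top_of_absolutelyContinuous {P : Measure Ω} [SigmaFinite P]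
    (hQμ : Q ≪ μ) : ∀ᵐ ω ∂Q, P.rnDeriv μ ω ≠ ⊤ :=
  hQμ.ae_le (Measure.rnDeriv_ne_top P μ)

theorem absolutelyContinuous_of_ae_rnDeriv_ne_zero {P : Measure Ω} [SigmaFinite μ] [SigmaFinite P]
    (hQμ : Q ≪ μ) (hPμ : P ≪ μ) (h : ∀ᵐ ω ∂Q, P.rnDeriv μ ω ≠ 0) : Q ≪ P := by
  refine Measure.AbsolutelyContinuous.mk fun A hA h0 => ?_
  rw [← Measure.withDensity_rnDeriv_eq P μ hPμ, withDensity_apply _ hA,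
    lintegral_eq_zero_iff (Measure.measurable_rnDeriv _ _)] at h0
  have h1 : ∀ᵐ ω ∂μ, ω ∈ A → P.rnDeriv μ ω = 0 := (ae_restrict_iff' hA).1 h0
  have h2 : ∀ᵐ ω ∂Q, ω ∉ A := by
    filter_upwards [hQμ.ae_le h1, h] with ω h3 h4 h5 using h4 (h3 h5)
  simpa [ae_iff] using h2

theorem extExpectation_le_maxDescriptionGain {P P' : Measure Ω} (hP' : P' ∈ H₀) :
    extExpectation Q (fun ω => ENNReal.log (P'.rnDeriv μ ω / P.rnDeriv μ ω)) ≤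
      maxDescriptionGain μ Q H₀ P := by
  unfold maxDescriptionGain
  split_ifs
  · exact le_iSup₂ (f := fun P' (_ : P' ∈ H₀) =>
      extExpectation Q (fun ω => ENNReal.log (P'.rnDeriv μ ω / P.rnDeriv μ ω))) P' hP'
  · exact le_top

theorem absolutelyContinuous_of_maxDescriptionGain_lt_top {P : Measure Ω}
    (h : maxDescriptionGain μ Q H₀ P < ⊤) : Q ≪ P := by
  by_contra hn
  simp [maxDescriptionGain, hn] at h

theorem maxDescriptionGain_nonneg [SigmaFinite μ] {P : Measure Ω} [SigmaFinite P] (hP : P ∈ H₀)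
    (hPμ : P ≪ μ) (hQμ : Q ≪ μ) : 0 ≤ maxDescriptionGain μ Q H₀ P := by
  by_cases hQP : Q ≪ P
  · refine le_trans (le_of_eq ?_) (extExpectation_le_maxDescriptionGain hP)
    have h : (fun ω => ENNReal.log (P.rnDeriv μ ω / P.rnDeriv μ ω)) =ᵐ[Q]
        fun _ => ((0 : ℝ) : EReal) := by
      filter_upwards [ae_rnDeriv_ne_zero_of_absolutelyContinuous hQP hPμ,
        ae_rnDeriv_ne_top_of_absolutelyContinuous (P := P) hQμ] with ω h0 h1
      rw [ENNReal.div_self h0 h1, ENNReal.log_one, EReal.coe_zero]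
    rw [extExpectation_congr_ae h, extExpectation_of_integrable (g := fun _ => (0 : ℝ)) (integrable_zero _ _ _)]
    simp
  · simp [maxDescriptionGain, hQP]

theorem rnDeriv_mixture [SigmaFinite μ] (P P' : Measure Ω) [SigmaFinite P] [SigmaFinite P']
    (a b : ℝ≥0) :
    (a • P + b • P').rnDeriv μ =ᵐ[μ] fun ω => a * P.rnDeriv μ ω + b * P'.rnDeriv μ ω := by
  filter_upwards [Measure.rnDeriv_add' (a • P) (b • P') μ, Measure.rnDeriv_smul_left' P μ a,
    Measure.rnDeriv_smul_left' P' μ b] with ω h1 h2 h3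
  rw [h1, Pi.add_apply, h2, h3]
  rfl

/-- Mixing in another element of a convex hypothesis cannot gain more than the maximum
description gain. -/
theorem lintegral_log_one_add_mul_ratio_le [IsProbabilityMeasure Q] [SigmaFinite μ]
    (h_prob : ∀ P ∈ H₀, IsProbabilityMeasure P) (hμ : ∀ P ∈ H₀, P ≪ μ) (hQμ : Q ≪ μ)
    (h_conv : Convex ℝ≥0 H₀) {P P' : Measure Ω} (hP : P ∈ H₀) (hP' : P' ∈ H₀) {h : ℝ}
    (hle : maxDescriptionGain μ Q H₀ P ≤ (h : EReal)) {t : ℝ} (ht : 0 < t) :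
    ∫⁻ ω, ENNReal.ofReal
        (Real.log (1 + t * ((P'.rnDeriv μ ω).toReal / (P.rnDeriv μ ω).toReal))) ∂Q ≤
      ENNReal.ofReal (h + Real.log (1 + t)) := by
  have := h_prob P hP
  have := h_prob P' hP'
  have hQP : Q ≪ P := absolutelyContinuous_of_maxDescriptionGain_lt_top
    (hle.trans_lt (EReal.coe_lt_top h))
  lift t to ℝ≥0 using ht.le
  have ht' : 0 < t := by exact_mod_cast ht
  -- With weights in the ratio 1 : t, the mixture has density ratio (1 + tR)/(1 + t) to `P`.
  set a : ℝ≥0 := 1 / (1 + t) with ha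
  set b : ℝ≥0 := t / (1 + t) with hb
  have hab : a + b = 1 := by
    rw [ha, hb, ← add_div, div_self (by positivity)]
  have hmem : a • P + b • P' ∈ H₀ := h_conv hP hP' zero_le zero_le hab
  set R : Ω → ℝ := fun ω => (P'.rnDeriv μ ω).toReal / (P.rnDeriv μ ω).toReal with hR
  have hRm : Measurable R := (Measure.measurable_rnDeriv _ _).ennreal_toReal.div
    (Measure.measurable_rnDeriv _ _).ennreal_toReal
  have hR0 : ∀ ω, 0 ≤ R ω := fun ω => by positivity
  set g : Ω → ℝ := fun ω => Real.log (1 + t * R ω) - Real.log (1 + t) with hg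
  have hgm : Measurable g := by fun_prop
  have hlog0 : ∀ ω, 0 ≤ Real.log (1 + t * R ω) := fun ω =>
    Real.log_nonneg (by have := mul_nonneg ht.le (hR0 ω); linarith)
  have hcongr : (fun ω => ENNReal.log ((a • P + b • P').rnDeriv μ ω / P.rnDeriv μ ω)) =ᵐ[Q]
      fun ω => (g ω : EReal) := by
    filter_upwards [ae_rnDeriv_ne_zero_of_absolutelyContinuous hQP (hμ P hP),
        ae_rnDeriv_ne_top_of_absolutelyContinuous (P := P) hQμ,
        ae_rnDeriv_ne_top_of_absolutelyContinuous (P := P') hQμ,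
        hQμ.ae_le (rnDeriv_mixture P P' a b)] with ω h0 h1 h2 h3
    have hp : 0 < (P.rnDeriv μ ω).toReal := ENNReal.toReal_pos h0 h1
    have ha0 : (a : ℝ≥0∞) ≠ 0 := by
      rw [ENNReal.coe_ne_zero]; positivity
    have hne : (a : ℝ≥0∞) * P.rnDeriv μ ω + b * P'.rnDeriv μ ω ≠ ⊤ :=
      ENNReal.add_ne_top.2 ⟨ENNReal.mul_ne_top ENNReal.coe_ne_top h1,
        ENNReal.mul_ne_top ENNReal.coe_ne_top h2⟩
    have hne0 : (a : ℝ≥0∞) * P.rnDeriv μ ω + b * P'.rnDeriv μ ω ≠ 0 := by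
      simp [ha0, h0]
    rw [h3, ENNReal.log_div_eq_coe hne0 hne h0 h1]
    congr 1
    rw [hg]
    have hpos : 0 < 1 + t * R ω := by have := mul_nonneg ht.le (hR0 ω); linarith
    have hval : ((a : ℝ≥0∞) * P.rnDeriv μ ω + b * P'.rnDeriv μ ω).toReal =
        (1 + t * R ω) / (1 + t) * (P.rnDeriv μ ω).toReal := by
      rw [ENNReal.toReal_add (ENNReal.mul_ne_top ENNReal.coe_ne_top h1)
        (ENNReal.mul_ne_top ENNReal.coe_ne_top h2), ENNReal.toReal_mul, ENNReal.toReal_mul,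
        ENNReal.coe_toReal, ENNReal.coe_toReal, ha, hb, hR]
      push_cast
      field_simp
    rw [hval, Real.log_mul (by positivity) hp.ne', Real.log_div hpos.ne' (by positivity)]
    ring
  have hext : extExpectation Q (fun ω => (g ω : EReal)) ≤ (h : EReal) := by
    rw [← extExpectation_congr_ae hcongr]
    exact (extExpectation_le_maxDescriptionGain hmem).trans hle
  -- Mixing keeps the log ratio above -log(1 + t), however small p' is.
  have hneg : ∫⁻ ω, ENNReal.ofReal (-g ω) ∂Q ≠ ⊤ := by
    refine ((lintegral_mono (g := fun _ => ENNReal.ofReal (Real.log (1 + t))) fun ω =>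
      ENNReal.ofReal_le_ofReal ?_).trans_lt ?_).ne
    · have := hlog0 ω
      simp only [hg]
      linarith
    · simp
  obtain ⟨hint, hle'⟩ := integrable_of_extExpectation_le hgm hneg hext
  have hint' : Integrable (fun ω => Real.log (1 + t * R ω)) Q := by
    have := hint.add (integrable_const (μ := Q) (Real.log (1 + t)))
    refine this.congr (ae_of_all _ fun ω => ?_)
    simp [hg]
  rw [← ofReal_integral_eq_lintegral_ofReal hint' (ae_of_all _ hlog0)]
  refine ENNReal.ofReal_le_ofReal ?_
  have : ∫ ω, g ω ∂Q = ∫ ω, Real.log (1 + t * R ω) ∂Q - Real.log (1 + t) := by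
    rw [hg, integral_sub hint' (integrable_const _)]
    simp
  linarith

/-- The logarithmic `L¹` distance of two elements of a convex hypothesis is controlled by their
maximum description gains. -/
theorem logL1Dist_rnDeriv_le [IsProbabilityMeasure Q] [SigmaFinite μ]
    (h_prob : ∀ P ∈ H₀, IsProbabilityMeasure P) (hμ : ∀ P ∈ H₀, P ≪ μ) (hQμ : Q ≪ μ)
    (h_conv : Convex ℝ≥0 H₀) {P P' : Measure Ω} (hP : P ∈ H₀) (hP' : P' ∈ H₀) {s : ℝ}
    (hs : 0 < s) (hs1 : s < 1) (hle : maxDescriptionGain μ Q H₀ P ≤ ((s ^ 2 : ℝ) : EReal))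
    (hle' : maxDescriptionGain μ Q H₀ P' ≤ ((s ^ 2 : ℝ) : EReal)) :
    logL1Dist Q (P.rnDeriv μ) (P'.rnDeriv μ) ≤ ENNReal.ofReal (4 * s) := by
  have := h_prob P hP
  have := h_prob P' hP'
  have hQP : Q ≪ P := absolutelyContinuous_of_maxDescriptionGain_lt_top
    (hle.trans_lt (EReal.coe_lt_top _))
  have hQP' : Q ≪ P' := absolutelyContinuous_of_maxDescriptionGain_lt_top
    (hle'.trans_lt (EReal.coe_lt_top _))
  have hlog2 : 0 ≤ Real.log 2 := Real.log_nonneg one_le_two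
  have h1 := lintegral_log_one_add_mul_ratio_le h_prob hμ hQμ h_conv hP' hP hle' one_pos
  have h2 := lintegral_log_one_add_mul_ratio_le h_prob hμ hQμ h_conv hP hP' hle one_pos
  simp only [one_mul] at h1 h2
  set p : Ω → ℝ := fun ω => (P.rnDeriv μ ω).toReal with hp
  set p' : Ω → ℝ := fun ω => (P'.rnDeriv μ ω).toReal with hp'
  have hpm : Measurable p := (Measure.measurable_rnDeriv _ _).ennreal_toReal
  have hpm' : Measurable p' := (Measure.measurable_rnDeriv _ _).ennreal_toReal
  have hpt : ∀ᵐ ω ∂Q, ENNReal.ofReal s *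
      (ENNReal.log (P.rnDeriv μ ω) - ENNReal.log (P'.rnDeriv μ ω)).abs +
        ENNReal.ofReal (2 * Real.log 2) ≤
      ENNReal.ofReal (Real.log (1 + p ω / p' ω)) + ENNReal.ofReal (Real.log (1 + p' ω / p ω)) +
        ENNReal.ofReal (2 * s ^ 2) := by
    filter_upwards [ae_rnDeriv_ne_zero_of_absolutelyContinuous hQP (hμ P hP),
        ae_rnDeriv_ne_top_of_absolutelyContinuous (P := P) hQμ,
        ae_rnDeriv_ne_zero_of_absolutelyContinuous hQP' (hμ P' hP'),
        ae_rnDeriv_ne_top_of_absolutelyContinuous (P := P') hQμ] with ω a0 a1 b0 b1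
    have h3 : 0 < p ω := ENNReal.toReal_pos a0 a1
    have h4 : 0 < p' ω := ENNReal.toReal_pos b0 b1
    have key := Real.mul_abs_log_le hs.le hs1 (div_pos h3 h4)
    rw [inv_div, Real.log_div h3.ne' h4.ne'] at key
    have l1 : 0 ≤ Real.log (1 + p ω / p' ω) :=
      Real.log_nonneg (by have := div_pos h3 h4; linarith)
    have l2 : 0 ≤ Real.log (1 + p' ω / p ω) :=
      Real.log_nonneg (by have := div_pos h4 h3; linarith)
    rw [ENNReal.abs_log_sub_log a0 a1 b0 b1, ← ofReal_norm, Real.norm_eq_abs,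
      ← ENNReal.ofReal_mul hs.le, ← ENNReal.ofReal_add (by positivity) (by positivity),
      ← ENNReal.ofReal_add l1 l2, ← ENNReal.ofReal_add (by positivity) (by positivity)]
    exact ENNReal.ofReal_le_ofReal key
  have hint := lintegral_mono_ae hpt
  have hm : Measurable fun ω =>
      (ENNReal.log (P.rnDeriv μ ω) - ENNReal.log (P'.rnDeriv μ ω)).abs :=
    ENNReal.measurable_abs_log_sub_log (Measure.measurable_rnDeriv _ _)
      (Measure.measurable_rnDeriv _ _)
  rw [lintegral_add_right _ measurable_const, lintegral_const_mul _ hm,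
    lintegral_add_right _ measurable_const, lintegral_add_left (by fun_prop), lintegral_const,
    lintegral_const, measure_univ, mul_one, mul_one] at hint
  change ENNReal.ofReal s * logL1Dist Q (P.rnDeriv μ) (P'.rnDeriv μ) + _ ≤ _ at hint
  -- The two gains contribute 2s² and the log cosh bound another 2s², which makes s · 4s; the two
  -- terms log 2 cancel against the left side.
  have hsum : ENNReal.ofReal s * logL1Dist Q (P.rnDeriv μ) (P'.rnDeriv μ) +
      ENNReal.ofReal (2 * Real.log 2) ≤
      ENNReal.ofReal s * ENNReal.ofReal (4 * s) + ENNReal.ofReal (2 * Real.log 2) := by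
    refine hint.trans ((add_le_add (add_le_add h1 h2) le_rfl).trans (le_of_eq ?_))
    rw [← ENNReal.ofReal_mul hs.le, one_add_one_eq_two,
      ← ENNReal.ofReal_add (by positivity) (by positivity),
      ← ENNReal.ofReal_add (by positivity) (by positivity),
      ← ENNReal.ofReal_add (by positivity) (by positivity)]
    congr 1
    ring
  have hfin := ENNReal.le_of_add_le_add_right ENNReal.ofReal_ne_top hsum
  exact (ENNReal.mul_le_mul_iff_right (by simpa using hs) ENNReal.ofReal_ne_top).1 hfin

end DescriptionGain

/-! ### Limits of sequences whose description gain vanishes -/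

theorem lintegral_le_of_tendsto_ae {Ω : Type*} [MeasurableSpace Ω] {Q : Measure Ω}
    {f : ℕ → Ω → ℝ≥0∞} {g : Ω → ℝ≥0∞} {c : ℕ → ℝ≥0∞} {C : ℝ≥0∞} (hf : ∀ n, Measurable (f n))
    (hfg : ∀ᵐ ω ∂Q, Tendsto (fun n => f n ω) atTop (𝓝 (g ω)))
    (hle : ∀ᶠ n in atTop, ∫⁻ ω, f n ω ∂Q ≤ c n) (hc : Tendsto c atTop (𝓝 C)) :
    ∫⁻ ω, g ω ∂Q ≤ C :=
  calc ∫⁻ ω, g ω ∂Q = ∫⁻ ω, liminf (fun n => f n ω) atTop ∂Q :=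
        lintegral_congr_ae (hfg.mono fun _ h => h.liminf_eq.symm)
    _ ≤ liminf (fun n => ∫⁻ ω, f n ω ∂Q) atTop := lintegral_liminf_le hf
    _ ≤ liminf c atTop := liminf_le_liminf hle
    _ = C := hc.liminf_eq

theorem ENNReal.exists_pos_lt_one_ofReal_four_mul_lt {ε : ℝ≥0∞} (hε : 0 < ε) :
    ∃ s : ℝ, 0 < s ∧ s < 1 ∧ ENNReal.ofReal (4 * s) < ε := by
  obtain ⟨δ, hδ0, hδ⟩ := ENNReal.lt_iff_exists_nnreal_btwn.1 hε
  have hδ0' : (0 : ℝ) < δ := by exact_mod_cast hδ0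
  refine ⟨min (1 / 2) (δ / 4), by positivity, (min_le_left _ _).trans_lt (by norm_num), ?_⟩
  refine lt_of_le_of_lt ?_ hδ
  rw [← ENNReal.ofReal_coe_nnreal]
  refine ENNReal.ofReal_le_ofReal ?_
  have := min_le_right (1 / 2 : ℝ) (δ / 4)
  linarith

section VanishingGain

variable {Ω : Type*} [MeasurableSpace Ω] {μ Q : Measure Ω} {H₀ : Set (Measure Ω)}

theorem eventually_maxDescriptionGain_le {p : ℕ → Measure Ω}
    (hH : Tendsto (fun n => maxDescriptionGain μ Q H₀ (p n)) atTop (𝓝 0)) {h : ℝ} (hh : 0 < h) :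
    ∀ᶠ n in atTop, maxDescriptionGain μ Q H₀ (p n) ≤ (h : EReal) :=
  (hH.eventually_lt_const (show (0 : EReal) < (h : EReal) by exact_mod_cast hh)).mono
    fun _ hn => hn.le

/-- The Cauchy property: pairs with gains at most s² are at distance at most 4s. -/
theorem eventually_logL1Dist_le [IsProbabilityMeasure Q] [SigmaFinite μ]
    (h_prob : ∀ P ∈ H₀, IsProbabilityMeasure P) (hμ : ∀ P ∈ H₀, P ≪ μ) (hQμ : Q ≪ μ)
    (h_conv : Convex ℝ≥0 H₀) {p : ℕ → Measure Ω} (hp : ∀ n, p n ∈ H₀)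
    (hH : Tendsto (fun n => maxDescriptionGain μ Q H₀ (p n)) atTop (𝓝 0)) {ε : ℝ≥0∞}
    (hε : 0 < ε) :
    ∃ N, ∀ m, N ≤ m → ∀ n, N ≤ n → logL1Dist Q ((p m).rnDeriv μ) ((p n).rnDeriv μ) < ε := by
  obtain ⟨s, hs, hs1, hsε⟩ := ENNReal.exists_pos_lt_one_ofReal_four_mul_lt hε
  obtain ⟨N, hN⟩ := eventually_atTop.1 (eventually_maxDescriptionGain_le hH (pow_pos hs 2))
  exact ⟨N, fun m hm n hn => (logL1Dist_rnDeriv_le h_prob hμ hQμ h_conv (hp m) (hp n) hs hs1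
    (hN m hm) (hN n hn)).trans_lt hsε⟩

/-- The logarithms of the densities of a sequence with vanishing maximum description gain converge
in `L¹(Q)`, and a subsequence of the densities converges almost surely. -/
theorem exists_tendsto_logL1Dist [IsProbabilityMeasure Q] [SigmaFinite μ]
    (h_prob : ∀ P ∈ H₀, IsProbabilityMeasure P) (hμ : ∀ P ∈ H₀, P ≪ μ) (hQμ : Q ≪ μ)
    (h_conv : Convex ℝ≥0 H₀) {p : ℕ → Measure Ω} (hp : ∀ n, p n ∈ H₀)
    (hH : Tendsto (fun n => maxDescriptionGain μ Q H₀ (p n)) atTop (𝓝 0)) :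
    ∃ r : Ω → ℝ≥0∞, Measurable r ∧ (∀ ω, r ω ≠ 0) ∧ (∀ ω, r ω ≠ ⊤) ∧
      Tendsto (fun n => logL1Dist Q ((p n).rnDeriv μ) r) atTop (𝓝 0) ∧
      ∃ φ : ℕ → ℕ, StrictMono φ ∧
        ∀ᵐ ω ∂Q, Tendsto (fun k => (p (φ k)).rnDeriv μ ω) atTop (𝓝 (r ω)) := by
  have hprob' : ∀ n, IsProbabilityMeasure (p n) := fun n => h_prob _ (hp n)
  have hcauchy := fun {ε : ℝ≥0∞} => eventually_logL1Dist_le h_prob hμ hQμ h_conv hp hH (ε := ε)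
  obtain ⟨N₁, hN₁⟩ := eventually_atTop.1 (eventually_maxDescriptionGain_le hH one_pos)
  obtain ⟨N₂, hN₂⟩ := hcauchy one_pos
  -- Beyond N the gains are finite, so the densities are Q-a.s. positive, and all mutual log
  -- distances are finite.
  set N := max N₁ N₂
  have hQp : ∀ n, Q ≪ p (n + N) := fun n => absolutelyContinuous_of_maxDescriptionGain_lt_top
    ((hN₁ _ ((le_max_left _ _).trans (Nat.le_add_left _ _))).trans_lt (EReal.coe_lt_top _))
  have hne0 : ∀ᵐ ω ∂Q, ∀ n, (p (n + N)).rnDeriv μ ω ≠ 0 := ae_all_iff.2 fun n =>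
    ae_rnDeriv_ne_zero_of_absolutelyContinuous (hQp n) (hμ _ (hp _))
  have hnetop : ∀ᵐ ω ∂Q, ∀ n, (p (n + N)).rnDeriv μ ω ≠ ⊤ := ae_all_iff.2 fun n =>
    ae_rnDeriv_ne_top_of_absolutelyContinuous hQμ
  set l : ℕ → Ω → ℝ := fun n ω => Real.log ((p (n + N)).rnDeriv μ ω).toReal with hl
  have hlm : ∀ n, Measurable (l n) := fun n =>
    (Measure.measurable_rnDeriv _ _).ennreal_toReal.log
  have hdist : ∀ m n, ∫⁻ ω, ‖l m ω - l n ω‖ₑ ∂Q =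
      logL1Dist Q ((p (m + N)).rnDeriv μ) ((p (n + N)).rnDeriv μ) := by
    intro m n
    refine lintegral_congr_ae ?_
    filter_upwards [hne0, hnetop] with ω h0 h1
    rw [ENNReal.abs_log_sub_log (h0 m) (h1 m) (h0 n) (h1 n)]
  -- A single log density need not be integrable; differences from a fixed one are, and completeness
  -- of L¹ applies to them.
  set u : ℕ → Ω → ℝ := fun n ω => l n ω - l 0 ω with hu
  have hum : ∀ n, Measurable (u n) := fun n => (hlm n).sub (hlm 0)
  have hmem : ∀ n, MemLp (u n) 1 Q := by
    intro n
    refine ⟨(hum n).aestronglyMeasurable, ?_⟩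
    rw [eLpNorm_one_eq_lintegral_enorm, hdist n 0]
    exact (hN₂ _ ((le_max_right _ _).trans (Nat.le_add_left _ _)) _
      ((le_max_right _ _).trans (Nat.le_add_left _ _))).trans ENNReal.one_lt_top
  have hcs : CauchySeq fun n => (hmem n).toLp (u n) := by
    refine EMetric.cauchySeq_iff.2 fun ε hε => ?_
    obtain ⟨M, hM⟩ := hcauchy hε
    refine ⟨M, fun m hm n hn => ?_⟩
    rw [Lp.edist_toLp_toLp, eLpNorm_one_eq_lintegral_enorm]
    have : ∀ ω, (u m - u n) ω = l m ω - l n ω := fun ω => by simp [hu]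
    simp only [this]
    rw [hdist]
    exact hM _ (hm.trans (Nat.le_add_right _ _)) _ (hn.trans (Nat.le_add_right _ _))
  obtain ⟨G, hG⟩ := cauchySeq_tendsto_of_complete hcs
  have hGm : Measurable G := (Lp.stronglyMeasurable G).measurable
  have hlim : Tendsto (fun n => eLpNorm (u n - ⇑G) 1 Q) atTop (𝓝 0) := by
    rw [← Lp.tendsto_Lp_iff_tendsto_eLpNorm'' u hmem G (Lp.memLp G), Lp.toLp_coeFn]
    exact hG
  set r : Ω → ℝ≥0∞ := fun ω => ENNReal.ofReal (Real.exp (G ω + l 0 ω)) with hr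
  have hr0 : ∀ ω, r ω ≠ 0 := fun ω => by
    simp only [hr, ne_eq, ENNReal.ofReal_eq_zero, not_le]
    exact Real.exp_pos _
  have hrtop : ∀ ω, r ω ≠ ⊤ := fun ω => ENNReal.ofReal_ne_top
  refine ⟨r, ((hGm.add (hlm 0)).exp).ennreal_ofReal, hr0, hrtop, ?_, ?_⟩
  · rw [← tendsto_add_atTop_iff_nat N]
    refine hlim.congr fun n => ?_
    rw [eLpNorm_one_eq_lintegral_enorm]
    refine lintegral_congr_ae ?_
    filter_upwards [hne0, hnetop] with ω h0 h1
    rw [ENNReal.abs_log_sub_log (h0 n) (h1 n) (hr0 ω) (hrtop ω)]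
    simp only [hr, hu, Pi.sub_apply, ENNReal.toReal_ofReal (Real.exp_pos _).le, Real.log_exp]
    congr 1
    simp only [hl]
    ring
  · obtain ⟨ns, hns, hns'⟩ := (tendstoInMeasure_of_tendsto_eLpNorm one_ne_zero
      (fun n => (hum n).aestronglyMeasurable) hGm.aestronglyMeasurable hlim).exists_seq_tendsto_ae
    refine ⟨fun k => ns k + N, fun a b hab => Nat.add_lt_add_right (hns hab) N, ?_⟩
    filter_upwards [hns', hne0, hnetop] with ω hω h0 h1
    have h2 : Tendsto (fun k => l (ns k) ω) atTop (𝓝 (G ω + l 0 ω)) := by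
      refine (hω.add_const (l 0 ω)).congr fun k => ?_
      simp [hu]
    refine (ENNReal.tendsto_ofReal ((Real.continuous_exp.tendsto _).comp h2)).congr fun k => ?_
    simp only [Function.comp_apply, hl]
    rw [Real.exp_log (ENNReal.toReal_pos (h0 _) (h1 _)), ENNReal.ofReal_toReal (h1 _)]

theorem Real.tendsto_natCast_mul_log_one_add_div (t : ℝ) :
    Tendsto (fun k : ℕ => ((k : ℝ) + 1) * Real.log (1 + 1 / ((k : ℝ) + 1) * t)) atTop (𝓝 t) := by
  have h := (Real.tendsto_mul_log_one_add_div_atTop t).comp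
    (tendsto_atTop_add_const_right atTop (1 : ℝ) tendsto_natCast_atTop_atTop)
  refine h.congr fun k => ?_
  simp only [Function.comp_apply, one_div_mul_eq_div]

/-- Every element of the hypothesis has `Q`-expected likelihood ratio at most one with respect to
an almost sure limit of a sequence with vanishing maximum description gain. -/
theorem lintegral_rnDeriv_div_limit_le_one [IsProbabilityMeasure Q] [SigmaFinite μ]
    (h_prob : ∀ P ∈ H₀, IsProbabilityMeasure P) (hμ : ∀ P ∈ H₀, P ≪ μ) (hQμ : Q ≪ μ)
    (h_conv : Convex ℝ≥0 H₀) {p : ℕ → Measure Ω} (hp : ∀ n, p n ∈ H₀)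
    (hH : Tendsto (fun n => maxDescriptionGain μ Q H₀ (p n)) atTop (𝓝 0)) {r : Ω → ℝ≥0∞}
    (hrm : Measurable r) (hr0 : ∀ ω, r ω ≠ 0) (hrtop : ∀ ω, r ω ≠ ⊤)
    (hlim : ∀ᵐ ω ∂Q, Tendsto (fun k => (p k).rnDeriv μ ω) atTop (𝓝 (r ω)))
    {P : Measure Ω} (hP : P ∈ H₀) : ∫⁻ ω, P.rnDeriv μ ω / r ω ∂Q ≤ 1 := by
  have := h_prob P hP
  set R : Ω → ℝ := fun ω => (P.rnDeriv μ ω).toReal / (r ω).toReal with hR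
  have hRm : Measurable R := (Measure.measurable_rnDeriv _ _).ennreal_toReal.div hrm.ennreal_toReal
  have hR0 : ∀ ω, 0 ≤ R ω := fun ω => by positivity
  have hstep : ∀ k : ℕ, ∫⁻ ω, ENNReal.ofReal
      (((k : ℝ) + 1) * Real.log (1 + 1 / ((k : ℝ) + 1) * R ω)) ∂Q ≤
        ENNReal.ofReal (1 / ((k : ℝ) + 1) + 1) := by
    intro k
    have hk : (0 : ℝ) < (k : ℝ) + 1 := by positivity
    have ht : (0 : ℝ) < 1 / ((k : ℝ) + 1) := by positivity
    set t : ℝ := 1 / ((k : ℝ) + 1) with htdef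
    have hkt : ((k : ℝ) + 1) * t = 1 := by rw [htdef]; field_simp
    -- Any positive bound on the gain holds eventually; t² is chosen because it is still negligible
    -- after division by t.
    have h1 : ∫⁻ ω, ENNReal.ofReal (Real.log (1 + t * R ω)) ∂Q ≤
        ENNReal.ofReal (t ^ 2 + Real.log (1 + t)) := by
      refine lintegral_le_of_tendsto_ae (f := fun n ω => ENNReal.ofReal
        (Real.log (1 + t * ((P.rnDeriv μ ω).toReal / ((p n).rnDeriv μ ω).toReal))))
        (fun n => ?_) ?_ ((eventually_maxDescriptionGain_le hH (pow_pos ht 2)).mono fun n hn =>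
          lintegral_log_one_add_mul_ratio_le h_prob hμ hQμ h_conv (hp n) hP hn ht)
        tendsto_const_nhds
      · have ha : Measurable fun ω => (P.rnDeriv μ ω).toReal :=
          (Measure.measurable_rnDeriv _ _).ennreal_toReal
        have hb : Measurable fun ω => ((p n).rnDeriv μ ω).toReal :=
          (Measure.measurable_rnDeriv _ _).ennreal_toReal
        fun_prop
      · filter_upwards [hlim] with ω hω
        have hrpos : 0 < (r ω).toReal := ENNReal.toReal_pos (hr0 ω) (hrtop ω)
        have h2 := (ENNReal.tendsto_toReal (hrtop ω)).comp hω
        have hpos : 1 + t * R ω ≠ 0 := by have := mul_nonneg ht.le (hR0 ω); positivity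
        refine ENNReal.tendsto_ofReal (Tendsto.log ?_ hpos)
        exact ((tendsto_const_nhds.div h2 hrpos.ne').const_mul t).const_add 1
    have hlog : Real.log (1 + t) ≤ t := by
      have := Real.log_le_sub_one_of_pos (show 0 < 1 + t by linarith); linarith
    simp only [ENNReal.ofReal_mul hk.le]
    rw [lintegral_const_mul _ (by fun_prop)]
    refine (mul_le_mul_right h1 _).trans ?_
    rw [← ENNReal.ofReal_mul hk.le]
    refine ENNReal.ofReal_le_ofReal ?_
    calc ((k : ℝ) + 1) * (t ^ 2 + Real.log (1 + t)) ≤ ((k : ℝ) + 1) * (t ^ 2 + t) := by gcongr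
      _ = t + 1 := by linear_combination (t + 1) * hkt
  have hbound : Tendsto (fun k : ℕ => ENNReal.ofReal (1 / ((k : ℝ) + 1) + 1)) atTop (𝓝 1) := by
    rw [← ENNReal.ofReal_one]
    refine ENNReal.tendsto_ofReal ?_
    simpa using (tendsto_one_div_add_atTop_nhds_zero_nat (𝕜 := ℝ)).add_const 1
  -- Second use of Fatou, now for t = 1/(k + 1) → 0, where log(1 + tR)/t → R.
  have hfin : ∫⁻ ω, ENNReal.ofReal (R ω) ∂Q ≤ 1 :=
    lintegral_le_of_tendsto_ae (fun k => by fun_prop) (ae_of_all _ fun ω =>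
      ENNReal.tendsto_ofReal (Real.tendsto_natCast_mul_log_one_add_div (R ω)))
      (Eventually.of_forall hstep) hbound
  refine (le_of_eq (lintegral_congr_ae ?_)).trans hfin
  filter_upwards [ae_rnDeriv_ne_top_of_absolutelyContinuous (P := P) hQμ] with ω h1
  simp only [hR]
  rw [← ENNReal.toReal_div, ENNReal.ofReal_toReal (ENNReal.div_ne_top h1 (hr0 ω))]

end VanishingGain

/-! ### Numeraires and the reverse information projection -/

section Numeraire

variable {Ω : Type*} [MeasurableSpace Ω] {μ Q : Measure Ω} {H₀ : Set (Measure Ω)}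

/-- A finite expectation makes {X = ∞} null under every element of the hypothesis, hence under Q;
the convention for ∞/∞ thus never matters below. -/
theorem IsEVariable.ae_ne_top {X : Ω → ℝ≥0∞} (hX : IsEVariable H₀ X) (hQ : AbsContSet Q H₀) :
    ∀ᵐ ω ∂Q, X ω ≠ ⊤ := by
  have h : Q {ω | X ω = ⊤} = 0 := hQ _ (hX.1 (measurableSet_singleton ⊤)) fun P hP => by
    have := ae_lt_top hX.1 ((hX.2 P hP).trans_lt ENNReal.one_lt_top).ne
    simpa [ae_iff] using this
  simpa [ae_iff] using h

theorem ENNReal.two_lt_div_add_div {x y : ℝ≥0∞} (hx : x ≠ 0) (hx' : x ≠ ⊤) (hy : y ≠ 0)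
    (hy' : y ≠ ⊤) (hxy : x ≠ y) : 2 < x / y + y / x := by
  have h1 : 0 < x.toReal := ENNReal.toReal_pos hx hx'
  have h2 : 0 < y.toReal := ENNReal.toReal_pos hy hy'
  have hne : x.toReal - y.toReal ≠ 0 := fun h =>
    hxy ((ENNReal.toReal_eq_toReal_iff' hx' hy').1 (by linarith))
  have hd1 := ENNReal.div_ne_top hx' hy
  have hd2 := ENNReal.div_ne_top hy' hx
  rw [← ENNReal.toReal_lt_toReal (by simp) (ENNReal.add_ne_top.2 ⟨hd1, hd2⟩),
    ENNReal.toReal_add hd1 hd2, ENNReal.toReal_div, ENNReal.toReal_div]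
  have : x.toReal / y.toReal + y.toReal / x.toReal - 2 =
      (x.toReal - y.toReal) ^ 2 / (x.toReal * y.toReal) := by
    field_simp
    ring
  have hpos : 0 < (x.toReal - y.toReal) ^ 2 / (x.toReal * y.toReal) := by positivity
  simp only [ENNReal.toReal_ofNat]
  linarith

/-- Testing each numeraire against the other gives E_Q[X/Y + Y/X] ≤ 2, while the integrand is at
least 2 with equality only where X = Y. -/
theorem IsNumeraire.ae_eq [IsProbabilityMeasure Q] (hQ : AbsContSet Q H₀) {X Y : Ω → ℝ≥0∞}
    (hX : IsNumeraire H₀ Q X) (hY : IsNumeraire H₀ Q Y) : X =ᵐ[Q] Y := by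
  have hXm := hX.1.1
  have hYm := hY.1.1
  have hXYm : Measurable fun ω => X ω / Y ω := hXm.div hYm
  have hYXm : Measurable fun ω => Y ω / X ω := hYm.div hXm
  have hXtop := hX.1.ae_ne_top hQ
  have hYtop := hY.1.ae_ne_top hQ
  have h1 : ∫⁻ ω, X ω / Y ω ∂Q ≤ 1 := by
    refine (le_of_eq (lintegral_congr_ae ?_)).trans (hY.2.2 X hX.1)
    filter_upwards [hXtop] with ω h
    simp [extRatio, h]
  have h2 : ∫⁻ ω, Y ω / X ω ∂Q ≤ 1 := by
    refine (le_of_eq (lintegral_congr_ae ?_)).trans (hX.2.2 Y hY.1)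
    filter_upwards [hYtop] with ω h
    simp [extRatio, h]
  have hle : ∫⁻ ω, (X ω / Y ω + Y ω / X ω) ∂Q ≤ 2 := by
    rw [lintegral_add_left hXYm, ← one_add_one_eq_two]
    exact add_le_add h1 h2
  have hge : ∀ᵐ ω ∂Q, 2 ≤ X ω / Y ω + Y ω / X ω := by
    filter_upwards [hXtop, hYtop, hX.2.1, hY.2.1] with ω a b c d
    by_cases hxy : X ω = Y ω
    · rw [hxy, ENNReal.div_self d.ne' b, one_add_one_eq_two]
    · exact (ENNReal.two_lt_div_add_div c.ne' a d.ne' b hxy).le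
  have hae := ae_eq_of_ae_le_of_lintegral_le hge (by simp)
    (hXYm.add hYXm).aemeasurable (by simpa using hle)
  filter_upwards [hXtop, hYtop, hX.2.1, hY.2.1, hae] with ω a b c d e
  by_contra hxy
  exact (ENNReal.two_lt_div_add_div c.ne' a d.ne' b hxy).ne e

theorem IsRIPr.unique [IsProbabilityMeasure Q] (hQ : AbsContSet Q H₀) {P P' : Measure Ω}
    (hP : IsRIPr H₀ Q P) (hP' : IsRIPr H₀ Q P') : P = P' := by
  obtain ⟨X, hX, rfl⟩ := hP
  obtain ⟨Y, hY, rfl⟩ := hP'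
  exact withDensity_congr_ae ((hX.ae_eq hQ hY).mono fun ω h => by simp only [h])

/-- A sequence with vanishing maximum description gain determines the reverse information
projection, and its log densities converge in `L¹(Q)` to that of the projection. -/
theorem exists_isRIPr_tendsto_logL1Dist [IsProbabilityMeasure Q] [SigmaFinite μ]
    (h_prob : ∀ P ∈ H₀, IsProbabilityMeasure P) (hμ : ∀ P ∈ H₀, P ≪ μ) (hQ : AbsContSet Q H₀)
    (h_conv : Convex ℝ≥0 H₀) {p : ℕ → Measure Ω} (hp : ∀ n, p n ∈ H₀)
    (hH : Tendsto (fun n => maxDescriptionGain μ Q H₀ (p n)) atTop (𝓝 0)) :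
    ∃ Pstar : Measure Ω, IsRIPr H₀ Q Pstar ∧
      Tendsto (fun n => logL1Dist Q ((p n).rnDeriv μ) (Pstar.rnDeriv μ)) atTop (𝓝 0) := by
  have hQμ := hQ.absolutelyContinuous hμ
  obtain ⟨r, hrm, hr0, hrtop, hdist, φ, hφ, hlim⟩ :=
    exists_tendsto_logL1Dist h_prob hμ hQμ h_conv hp hH
  set q : Ω → ℝ≥0∞ := Q.rnDeriv μ with hq
  have hqm : Measurable q := Measure.measurable_rnDeriv _ _
  have hqrm : Measurable fun ω => q ω / r ω := hqm.div hrm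
  have hq0 : ∀ᵐ ω ∂Q, q ω ≠ 0 := (Measure.rnDeriv_pos hQμ).mono fun _ h => h.ne'
  have hqtop : ∀ᵐ ω ∂Q, q ω ≠ ⊤ := ae_rnDeriv_ne_top_of_absolutelyContinuous hQμ
  have hinv : ∀ᵐ ω ∂Q, (q ω / r ω)⁻¹ = r ω / q ω := ae_of_all _ fun ω =>
    ENNReal.inv_div (Or.inl (hrtop ω)) (Or.inl (hr0 ω))
  have hE : IsEVariable H₀ fun ω => q ω / r ω := by
    refine ⟨hqrm, fun P hP => ?_⟩
    have := h_prob P hP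
    rw [← lintegral_rnDeriv_mul (hμ P hP) hqrm.aemeasurable]
    have hPrm : Measurable fun ω => P.rnDeriv μ ω / r ω := (Measure.measurable_rnDeriv P μ).div hrm
    -- Both sides are ∫ p q / r dμ, which exchanges the roles of P and Q.
    have h1 : ∫⁻ ω, P.rnDeriv μ ω * (q ω / r ω) ∂μ = ∫⁻ ω, P.rnDeriv μ ω / r ω ∂Q := by
      rw [← lintegral_rnDeriv_mul hQμ hPrm.aemeasurable]
      refine lintegral_congr fun ω => ?_
      rw [div_eq_mul_inv, div_eq_mul_inv]
      ring
    rw [h1]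
    exact lintegral_rnDeriv_div_limit_le_one h_prob hμ hQμ h_conv (fun k => hp (φ k))
      (hH.comp hφ.tendsto_atTop) hrm hr0 hrtop hlim hP
  have hN : IsNumeraire H₀ Q fun ω => q ω / r ω := by
    refine ⟨hE, hq0.mono fun ω h => ENNReal.div_pos h (hrtop ω), fun X hX => ?_⟩
    have hXqm : ∀ k, Measurable fun ω => X ω * (p (φ k)).rnDeriv μ ω / q ω := fun k =>
      (hX.1.mul (Measure.measurable_rnDeriv _ _)).div hqm
    have hfatou : ∫⁻ ω, X ω * r ω / q ω ∂Q ≤ 1 := by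
      refine lintegral_le_of_tendsto_ae (f := fun k ω => X ω * (p (φ k)).rnDeriv μ ω / q ω)
        hXqm ?_ (Eventually.of_forall fun k => ?_) tendsto_const_nhds
      · filter_upwards [hlim, hq0] with ω h1 h2
        exact ENNReal.Tendsto.div_const (ENNReal.Tendsto.const_mul h1 (Or.inl (hr0 ω))) (Or.inr h2)
      · have := h_prob _ (hp (φ k))
        rw [← lintegral_rnDeriv_mul hQμ (hXqm k).aemeasurable]
        -- Only an inequality, since q may vanish on a set that carries mass of `p (φ k)`.
        refine (lintegral_mono fun ω => ENNReal.mul_div_le).trans ?_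
        refine le_trans (le_of_eq ?_) (hX.2 _ (hp (φ k)))
        rw [← lintegral_rnDeriv_mul (hμ _ (hp (φ k))) hX.1.aemeasurable]
        exact lintegral_congr fun ω => mul_comm _ _
    refine (le_of_eq (lintegral_congr_ae ?_)).trans hfatou
    filter_upwards [hE.ae_ne_top hQ, hinv] with ω h1 h2
    rw [extRatio, if_neg fun h => h1 h.2, div_eq_mul_inv, h2, mul_div_assoc]
  refine ⟨Q.withDensity fun ω => (q ω / r ω)⁻¹, ⟨_, hN, rfl⟩, hdist.congr fun n => ?_⟩
  refine logL1Dist_congr_right _ ?_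
  filter_upwards [hQμ.ae_le (Measure.rnDeriv_withDensity_left_of_absolutelyContinuous hQμ
    hqrm.inv.aemeasurable), hq0, hqtop, hinv] with ω h1 h2 h3 h4
  refine Eq.trans ?_ h1.symm
  change r ω = (q ω / r ω)⁻¹ * q ω
  rw [h4, ENNReal.div_mul_cancel h2 h3]

end Numeraire

/-! ### The infimum of the maximum description gain -/

section Infimum

variable {Ω : Type*} [MeasurableSpace Ω] {μ Q : Measure Ω} {H₀ : Set (Measure Ω)}

/-- Switching to an element that nearly attains the maximum description gain of `P` leaves almost
no description gain. -/
theorem maxDescriptionGain_le_of_lt_extExpectation [IsProbabilityMeasure Q] [SigmaFinite μ]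
    (h_prob : ∀ P ∈ H₀, IsProbabilityMeasure P) (hμ : ∀ P ∈ H₀, P ≪ μ) (hQμ : Q ≪ μ)
    {P P' : Measure Ω} (hP : P ∈ H₀) (hP' : P' ∈ H₀) {S ε : ℝ}
    (hS : maxDescriptionGain μ Q H₀ P ≤ (S : EReal))
    (hlt : ((S - ε : ℝ) : EReal) <
      extExpectation Q (fun ω => ENNReal.log (P'.rnDeriv μ ω / P.rnDeriv μ ω))) :
    maxDescriptionGain μ Q H₀ P' ≤ (ε : EReal) := by
  have := h_prob P hP
  have := h_prob P' hP'
  have hQP : Q ≪ P := absolutelyContinuous_of_maxDescriptionGain_lt_top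
    (hS.trans_lt (EReal.coe_lt_top S))
  have hp0 := ae_rnDeriv_ne_zero_of_absolutelyContinuous hQP (hμ P hP)
  have hlogm : ∀ P₁ : Measure Ω, Measurable fun ω => Real.log (P₁.rnDeriv μ ω).toReal := fun P₁ =>
    (Measure.measurable_rnDeriv _ _).ennreal_toReal.log
  have hsubm : ∀ P₁ P₂ : Measure Ω, Measurable fun ω =>
      Real.log (P₁.rnDeriv μ ω).toReal - Real.log (P₂.rnDeriv μ ω).toReal := fun P₁ P₂ =>
    (hlogm P₁).sub (hlogm P₂)
  have hlogm' : ∀ P₁ P₂ : Measure Ω, Measurable fun ω =>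
      (-ENNReal.log (P₁.rnDeriv μ ω / P₂.rnDeriv μ ω)).toENNReal := fun P₁ P₂ =>
    (((Measure.measurable_rnDeriv _ _).div (Measure.measurable_rnDeriv _ _)).ennreal_log.neg
      ).ereal_toENNReal
  -- A zero of the first density gives log 0 = -∞, so zeros of positive Q-mass would make the
  -- expectation -∞.
  have hpos : ∀ P₁ P₂ : Measure Ω,
      extExpectation Q (fun ω => ENNReal.log (P₁.rnDeriv μ ω / P₂.rnDeriv μ ω)) ≠ ⊥ →
      ∀ᵐ ω ∂Q, P₁.rnDeriv μ ω ≠ 0 := by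
    intro P₁ P₂ hne
    filter_upwards [ae_lt_top (hlogm' P₁ P₂)
      (lintegral_neg_part_ne_top_of_extExpectation_ne_bot hne)] with ω h h0
    simp [h0] at h
  have hcongr : ∀ P₁ ∈ H₀, ∀ P₂ ∈ H₀, (∀ᵐ ω ∂Q, P₁.rnDeriv μ ω ≠ 0) →
      (∀ᵐ ω ∂Q, P₂.rnDeriv μ ω ≠ 0) →
      (fun ω => ENNReal.log (P₁.rnDeriv μ ω / P₂.rnDeriv μ ω)) =ᵐ[Q] fun ω =>
        ((Real.log (P₁.rnDeriv μ ω).toReal - Real.log (P₂.rnDeriv μ ω).toReal : ℝ) : EReal) := by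
    intro P₁ h₁ P₂ h₂ a b
    have := h_prob P₁ h₁
    have := h_prob P₂ h₂
    filter_upwards [a, b, ae_rnDeriv_ne_top_of_absolutelyContinuous (P := P₁) hQμ,
      ae_rnDeriv_ne_top_of_absolutelyContinuous (P := P₂) hQμ] with ω c d e f
    exact ENNReal.log_div_eq_coe c e d f
  have hneg : ∀ g : Ω → ℝ, extExpectation Q (fun ω => (g ω : EReal)) ≠ ⊥ →
      ∫⁻ ω, ENNReal.ofReal (-g ω) ∂Q ≠ ⊤ := by
    intro g hg
    simpa only [← EReal.coe_neg, EReal.real_coe_toENNReal] using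
      lintegral_neg_part_ne_top_of_extExpectation_ne_bot hg
  have hp'0 := hpos P' P (ne_bot_of_gt hlt)
  have hQP' : Q ≪ P' := absolutelyContinuous_of_ae_rnDeriv_ne_zero hQμ (hμ P' hP') hp'0
  rw [extExpectation_congr_ae (hcongr P' hP' P hP hp'0 hp0)] at hlt
  have hle := (extExpectation_le_maxDescriptionGain (μ := μ) (Q := Q) (P := P) hP').trans hS
  rw [extExpectation_congr_ae (hcongr P' hP' P hP hp'0 hp0)] at hle
  obtain ⟨hint, -⟩ := integrable_of_extExpectation_le (hsubm P' P)
    (hneg _ (ne_bot_of_gt hlt)) hle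
  rw [extExpectation_of_integrable hint, EReal.coe_lt_coe_iff] at hlt
  rw [maxDescriptionGain, if_pos hQP']
  refine iSup₂_le fun P'' hP'' => ?_
  by_cases hbot : extExpectation Q
      (fun ω => ENNReal.log (P''.rnDeriv μ ω / P'.rnDeriv μ ω)) = ⊥
  · rw [hbot]; exact bot_le
  have hp''0 := hpos P'' P' hbot
  rw [extExpectation_congr_ae (hcongr P'' hP'' P' hP' hp''0 hp'0)] at hbot ⊢
  have hle'' := (extExpectation_le_maxDescriptionGain (μ := μ) (Q := Q) (P := P) hP'').trans hS
  rw [extExpectation_congr_ae (hcongr P'' hP'' P hP hp''0 hp0)] at hle''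
  -- The negative part of log(p''/p) is at most the sum of those of log(p''/p') and log(p'/p).
  have hneg'' : ∫⁻ ω, ENNReal.ofReal
      (-(Real.log (P''.rnDeriv μ ω).toReal - Real.log (P.rnDeriv μ ω).toReal)) ∂Q ≠ ⊤ := by
    refine (lt_of_le_of_lt (lintegral_mono fun ω => ?_) (ENNReal.add_lt_top.2
      ⟨(hneg _ hbot).lt_top, hint.neg.lintegral_lt_top⟩ |>.trans_le' (lintegral_add_left
        ((hsubm P'' P').neg.ennreal_ofReal) _).le)).ne
    refine le_trans (ENNReal.ofReal_le_ofReal (le_of_eq ?_)) ENNReal.ofReal_add_le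
    simp only [Pi.neg_apply]
    ring
  obtain ⟨hint'', hle3⟩ := integrable_of_extExpectation_le (hsubm P'' P) hneg'' hle''
  -- Integrated, this bounds the gain from p' to p'' by S - (S - ε) = ε.
  have heq : (fun ω => Real.log (P''.rnDeriv μ ω).toReal - Real.log (P'.rnDeriv μ ω).toReal) =
      fun ω => (Real.log (P''.rnDeriv μ ω).toReal - Real.log (P.rnDeriv μ ω).toReal) -
        (Real.log (P'.rnDeriv μ ω).toReal - Real.log (P.rnDeriv μ ω).toReal) := by
    ext ω; ring
  have hint3 : Integrable (fun ω => Real.log (P''.rnDeriv μ ω).toReal -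
      Real.log (P'.rnDeriv μ ω).toReal) Q := by
    rw [heq]; exact hint''.sub hint
  rw [extExpectation_of_integrable hint3, EReal.coe_le_coe_iff, heq, integral_sub hint'' hint]
  linarith

theorem exists_maxDescriptionGain_le [IsProbabilityMeasure Q] [SigmaFinite μ]
    (h_prob : ∀ P ∈ H₀, IsProbabilityMeasure P) (hμ : ∀ P ∈ H₀, P ≪ μ) (hQμ : Q ≪ μ)
    {P : Measure Ω} (hP : P ∈ H₀) (hH : maxDescriptionGain μ Q H₀ P < ⊤) {ε : ℝ} (hε : 0 < ε) :
    ∃ P' ∈ H₀, maxDescriptionGain μ Q H₀ P' ≤ (ε : EReal) := by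
  have := h_prob P hP
  have hnonneg := maxDescriptionGain_nonneg hP (hμ P hP) hQμ
  have hQP := absolutelyContinuous_of_maxDescriptionGain_lt_top hH
  obtain ⟨S, hS⟩ : ∃ S : ℝ, maxDescriptionGain μ Q H₀ P = S :=
    ⟨_, (EReal.coe_toReal hH.ne (ne_bot_of_le_ne_bot EReal.zero_ne_bot hnonneg)).symm⟩
  have hlt : ((S - ε : ℝ) : EReal) < maxDescriptionGain μ Q H₀ P := by
    rw [hS, EReal.coe_lt_coe_iff]; linarith
  rw [maxDescriptionGain, if_pos hQP] at hlt
  obtain ⟨P', hlt⟩ := lt_iSup_iff.1 hlt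
  obtain ⟨hP', hlt⟩ := lt_iSup_iff.1 hlt
  exact ⟨P', hP', maxDescriptionGain_le_of_lt_extExpectation h_prob hμ hQμ hP hP' hS.le hlt⟩

/-- If some maximum description gain is finite, the maximum description gain can be made to
vanish, and its infimum is zero. -/
theorem exists_seq_tendsto_maxDescriptionGain_zero [IsProbabilityMeasure Q] [SigmaFinite μ]
    (h_prob : ∀ P ∈ H₀, IsProbabilityMeasure P) (hμ : ∀ P ∈ H₀, P ≪ μ) (hQμ : Q ≪ μ)
    {P : Measure Ω} (hP : P ∈ H₀) (hH : maxDescriptionGain μ Q H₀ P < ⊤) :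
    (⨅ P ∈ H₀, maxDescriptionGain μ Q H₀ P) = 0 ∧
    ∃ p : ℕ → Measure Ω, (∀ n, p n ∈ H₀) ∧
      Tendsto (fun n => maxDescriptionGain μ Q H₀ (p n)) atTop (𝓝 0) := by
  have hnonneg : ∀ P ∈ H₀, 0 ≤ maxDescriptionGain μ Q H₀ P := fun P hP => by
    have := h_prob P hP
    exact maxDescriptionGain_nonneg hP (hμ P hP) hQμ
  choose p hp hle using fun n : ℕ => exists_maxDescriptionGain_le h_prob hμ hQμ hP hH
    (ε := 1 / ((n : ℝ) + 1)) (by positivity)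
  have hlim : Tendsto (fun n => maxDescriptionGain μ Q H₀ (p n)) atTop (𝓝 0) := by
    refine tendsto_of_tendsto_of_tendsto_of_le_of_le tendsto_const_nhds ?_
      (fun n => hnonneg _ (hp n)) hle
    exact (continuous_coe_real_ereal.tendsto 0).comp tendsto_one_div_add_atTop_nhds_zero_nat
  refine ⟨le_antisymm ?_ (le_iInf₂ hnonneg), p, hp, hlim⟩
  exact ge_of_tendsto' hlim fun n => iInf₂_le (p n) (hp n)

end Infimum

theorem corollary4p10 {Ω : Type*} [MeasurableSpace Ω]
    (μ Q : Measure Ω) [IsProbabilityMeasure μ] [IsProbabilityMeasure Q]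
    (H₀ : Set (Measure Ω)) (h_prob : ∀ P ∈ H₀, IsProbabilityMeasure P)
    (hQ : AbsContSet Q H₀) (hμ : ∀ P ∈ H₀, P ≪ μ) (h_conv : Convex ℝ≥0 H₀) :
    (∀ p : ℕ → Measure Ω, (∀ n, p n ∈ H₀) →
      Tendsto (fun n => maxDescriptionGain μ Q H₀ (p n)) atTop (𝓝 0) →
      ∃ Pstar : Measure Ω, IsRIPr H₀ Q Pstar ∧
        (∀ P' : Measure Ω, IsRIPr H₀ Q P' → P' = Pstar) ∧
        Tendsto (fun n => logL1Dist Q ((p n).rnDeriv μ) (Pstar.rnDeriv μ)) atTop (𝓝 0)) ∧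
    ((∃ P ∈ H₀, maxDescriptionGain μ Q H₀ P < ⊤) →
      ∃ Pstar : Measure Ω, IsRIPr H₀ Q Pstar ∧
        (∀ P' : Measure Ω, IsRIPr H₀ Q P' → P' = Pstar) ∧
        ∀ r : Ω → ℝ≥0∞, Measurable r →
          (IsDescriptionGainProjection μ Q H₀ r ↔ r =ᵐ[Q] Pstar.rnDeriv μ)) := by
  have hmain := fun (p : ℕ → Measure Ω) (hp : ∀ n, p n ∈ H₀)
    (hH : Tendsto (fun n => maxDescriptionGain μ Q H₀ (p n)) atTop (𝓝 0)) =>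
    exists_isRIPr_tendsto_logL1Dist h_prob hμ hQ h_conv hp hH
  refine ⟨fun p hp hH => ?_, ?_⟩
  · obtain ⟨Pstar, hR, hlim⟩ := hmain p hp hH
    exact ⟨Pstar, hR, fun P' hP' => hP'.unique hQ hR, hlim⟩
  · rintro ⟨P, hP, hfin⟩
    obtain ⟨hinf, p, hp, hH⟩ := exists_seq_tendsto_maxDescriptionGain_zero h_prob hμ
      (hQ.absolutelyContinuous hμ) hP hfin
    obtain ⟨Pstar, hR, hlim⟩ := hmain p hp hH
    refine ⟨Pstar, hR, fun P' hP' => hP'.unique hQ hR, fun r hr => ⟨fun h => ?_, fun h => ?_⟩⟩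
    · have hlim' := h.2 p hp (by rw [hinf]; exact hH)
      -- The same sequence converges to both candidates, so the triangle inequality forces their
      -- distance to be 0.
      refine ae_eq_of_logL1Dist_eq_zero hr (Measure.measurable_rnDeriv _ _) (le_antisymm ?_ zero_le)
      have hsum := hlim'.add hlim
      rw [add_zero] at hsum
      refine ge_of_tendsto' hsum fun n => ?_
      rw [logL1Dist_comm Q _ r]
      exact logL1Dist_triangle Q hr (Measure.measurable_rnDeriv _ _)
    · refine ⟨hr, fun p' hp' hH' => ?_⟩
      rw [hinf] at hH'
      -- Each sequence produces its own projection; uniqueness identifies it with `Pstar`.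
      obtain ⟨P₂, hR₂, hlim₂⟩ := hmain p' hp' hH'
      rw [hR₂.unique hQ hR] at hlim₂
      simpa only [logL1Dist_congr_right _ h] using hlim₂
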